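/- Let $(R,\mathfrak m,k)$ be a commutative Noetherian local ring. A finitely generated module $M$ over a commutative ring $A$ is totally reflexive if $M\to M^{**}$ is an isomorphism and $\operatorname{Ext}^i_A(M,A)=0=\operatorname{Ext}^i_A(M^*,A)$ for all $i>0$, where $(-)^*=\operatorname{Hom}_A(-,A)$; the ring $A$ is G-regular if every totally reflexive $A$-module is free. A proper ideal $I$ of $R$ is quasi-Gorenstein if $\operatorname{Ext}^i_R(R/I,R)\cong R/I$ for $i=\operatorname{grade} I$ and $\operatorname{Ext}^i_R(R/I,R)=0$ for all $i\neq\operatorname{grade} I$. For an ideal $L$ of $R$, let $\operatorname{s}(L)\in\mathbb N\cup\{\infty\}$ be the supremum of the minimal numbers of generators of the ideals of $R/L$. Let $I$ be a quasi-Gorenstein ideal of $R$ of grade $0$, and assume that (a) $(0:_RI^2)=(0:_RI)$, or (b) $R/I$ is G-regular. Then for all integers $n$ with $0<n<\operatorname{s}(I+(0:_RI))$ there exist families of exact sequences of $R$-modules $$\{0\to (R/I)^n\to M_{n,u}\to R/(0:_RI)\to 0\}_{u\in R}$$ such that each $M_{n,u}$ is a non-free indecomposable totally reflexive $R$-module,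 and such that, for all integers $n,m$ with $0<n,m<\operatorname{s}(I+(0:_RI))$ and all $u,v\in R$, if $M_{n,u}\cong M_{m,v}$ then $n=m$ and $\overline u=\overline v$ in $k$. -/

import Mathlib

universe u

open CategoryTheory

/-- A finitely generated module `M` over a commutative ring `R` is *totally reflexive* if the
evaluation map `M → M**` is an isomorphism and `Ext^i(M, R) = 0 = Ext^i(M*, R)` for all `i > 0`. -/
structure IsTotallyReflexive (R : Type u) [CommRing R] (M : Type u) [AddCommGroup M]
    [Module R M] : Prop where
  finite : Module.Finite R M
  bijective_eval : Function.Bijective (Module.Dual.eval R M)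
  subsingleton_ext : ∀ i : ℕ, 0 < i →
    Subsingleton (Abelian.Ext (ModuleCat.of R M) (ModuleCat.of R R) i)
  subsingleton_ext_dual : ∀ i : ℕ, 0 < i →
    Subsingleton (Abelian.Ext (ModuleCat.of R (Module.Dual R M)) (ModuleCat.of R R) i)

/-- A ring is *G-regular* if all its totally reflexive modules are free. -/
def IsGRegular (R : Type u) [CommRing R] : Prop :=
  ∀ (M : Type u) [AddCommGroup M] [Module R M], IsTotallyReflexive R M → Module.Free R M

/-- The *grade* of an ideal `I`: the supremum of the lengths of the `R`-regular sequences
consisting of elements of `I`. -/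
noncomputable def idealGrade {R : Type u} [CommRing R] (I : Ideal R) : ℕ∞ :=
  ⨆ (rs : List R) (_ : ∀ r ∈ rs, r ∈ I) (_ : RingTheory.Sequence.IsRegular R rs),
    (rs.length : ℕ∞)

/-- A proper ideal `I` is *quasi-Gorenstein* if `Ext^i(R/I, R)` is isomorphic to `R/I` for
`i = grade I` and vanishes for every other `i`. -/
structure IsQuasiGorenstein {R : Type u} [CommRing R] (I : Ideal R) : Prop where
  ne_top : I ≠ ⊤
  ext_grade : ∀ i : ℕ, (i : ℕ∞) = idealGrade I →
    Nonempty (Abelian.Ext (ModuleCat.of R (R ⧸ I)) (ModuleCat.of R R) i ≃ₗ[R] (R ⧸ I))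
  ext_other : ∀ i : ℕ, (i : ℕ∞) ≠ idealGrade I →
    Subsingleton (Abelian.Ext (ModuleCat.of R (R ⧸ I)) (ModuleCat.of R R) i)

/-- `s(I)`: the supremum, over all ideals `𝔞` of the Noetherian ring `R/I`, of the minimal number
of generators of `𝔞`. It may be infinite. -/
noncomputable def supGenerators {R : Type u} [CommRing R] (I : Ideal R) : ℕ∞ :=
  ⨆ 𝔞 : Ideal (R ⧸ I), (Submodule.spanFinrank 𝔞 : ℕ∞)

/-- A module is *indecomposable* if it is nonzero and is not the direct sum of two nonzero
submodules. -/
def IsIndecomposableModule (R : Type u) [CommRing R] (M : Type u) [AddCommGroup M]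
    [Module R M] : Prop :=
  Nontrivial M ∧ ∀ X Y : Submodule R M, IsCompl X Y → X = ⊥ ∨ Y = ⊥

/-- The ideal `(0 : I)`. -/
abbrev zeroColon {R : Type u} [CommRing R] (I : Ideal R) : Ideal R :=
  (⊥ : Ideal R).colon (I : Set R)

/-! In grade 0, the quasi-Gorenstein condition gives Hom(R/I, R) ≅ R/I, hence an x with I = (0 : x)
and (0 : I) = (x) (`exists_annihilatorPair`); the Ext vanishing makes R/I totally reflexive. For a
in Rⁿ let M be the cokernel of (x, a) : R/I → R ⊕ (R/I)ⁿ, an extension of R/(x) by (R/I)ⁿ.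
Functionals on R/I extend to R ⊕ (R/I)ⁿ, so M is totally reflexive.

Put L = I + (0 : I), choose c₀, …, cₙ minimal modulo L, and let a = (c₁ + u c₀, c₂, …, cₙ).

Indecomposability: since R/(x) is local and cyclic, one of two complementary summands maps onto it,
and the other, Y, is then a quotient of (R/I)ⁿ. Either hypothesis makes Y free over R/I
(`subsingleton_of_split`). If Y ≠ 0, some map M → R/I is onto on (R/I)ⁿ, which minimality of a
forbids (`not_surjective_comp_incl`).

Isomorphism classes: M has n + 1 minimal generators, and for J ⊇ I it maps onto (R/J)ⁿ⁺¹ exactly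
when J contains x and all aᵢ. So n and L + (a) are invariants, and L + (a) determines u modulo the
maximal ideal. -/

/-- All `Ext^i(M, R)` with `i > 0` vanish. -/
def ExtVanishes (R : Type u) [CommRing R] (M : Type u) [AddCommGroup M] [Module R M] : Prop :=
  ∀ i : ℕ, 0 < i → Subsingleton (Abelian.Ext (ModuleCat.of R M) (ModuleCat.of R R) i)

/-! ### Vanishing of Ext along retracts and short exact sequences. -/

namespace ExtVanishes

variable {R : Type u} [CommRing R] {A B C : Type u} [AddCommGroup A] [Module R A]
  [AddCommGroup B] [Module R B] [AddCommGroup C] [Module R C]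

theorem of_retract (s : A →ₗ[R] B) (p : B →ₗ[R] A) (h : p ∘ₗ s = LinearMap.id)
    (hB : ExtVanishes R B) : ExtVanishes R A := by
  intro i hi
  have := hB i hi
  refine subsingleton_of_forall_eq 0 fun α => ?_
  have h1 : ModuleCat.ofHom s ≫ ModuleCat.ofHom p = 𝟙 (ModuleCat.of R A) := by
    rw [← ModuleCat.ofHom_comp, h]; rfl
  have h2 : (Abelian.Ext.mk₀ (ModuleCat.ofHom p)).comp α (zero_add i) = 0 :=
    Subsingleton.elim _ _
  rw [← Abelian.Ext.mk₀_id_comp α, ← h1, ← Abelian.Ext.mk₀_comp_mk₀_assoc, h2,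
    Abelian.Ext.comp_zero]

theorem of_equiv (e : A ≃ₗ[R] B) (hB : ExtVanishes R B) : ExtVanishes R A :=
  hB.of_retract e.toLinearMap e.symm.toLinearMap (by ext; simp)

theorem self (R : Type u) [CommRing R] : ExtVanishes R R := fun i hi => by
  obtain ⟨j, rfl⟩ := Nat.exists_eq_succ_of_ne_zero hi.ne'
  have : Projective (ModuleCat.of R R) :=
    (IsProjective.iff_projective R).1 inferInstance
  exact Abelian.Ext.subsingleton_of_projective _ _ _

theorem of_subsingleton [Subsingleton A] : ExtVanishes R A :=
  (ExtVanishes.self R).of_retract (0 : A →ₗ[R] R) (0 : R →ₗ[R] A)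
    (LinearMap.ext fun _ => Subsingleton.elim _ _)

variable {f : A →ₗ[R] B} {g : B →ₗ[R] C}

theorem shortExact (hf : Function.Injective f) (hfg : Function.Exact f g)
    (hg : Function.Surjective g) :
    (ShortComplex.mk (ModuleCat.ofHom f) (ModuleCat.ofHom g)
      (by rw [← ModuleCat.ofHom_comp, hfg.linearMap_comp_eq_zero]; rfl)).ShortExact :=
  ModuleCat.shortComplex_shortExact _ hfg hf hg

theorem middle (hf : Function.Injective f) (hfg : Function.Exact f g)
    (hg : Function.Surjective g) (hA : ExtVanishes R A) (hC : ExtVanishes R C) :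
    ExtVanishes R B := by
  intro i hi
  have := hA i hi
  have := hC i hi
  refine subsingleton_of_forall_eq 0 fun α => ?_
  obtain ⟨β, rfl⟩ := Abelian.Ext.contravariant_sequence_exact₂ (shortExact hf hfg hg) _ α
    (Subsingleton.elim _ _)
  have : β = 0 := Subsingleton.elim _ _
  rw [this, Abelian.Ext.comp_zero]

theorem left (hf : Function.Injective f) (hfg : Function.Exact f g)
    (hg : Function.Surjective g) (hB : ExtVanishes R B) (hC : ExtVanishes R C) :
    ExtVanishes R A := by
  intro i hi
  have := hB i hi
  have := hC (1 + i) (by omega)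
  refine subsingleton_of_forall_eq 0 fun α => ?_
  obtain ⟨β, rfl⟩ := Abelian.Ext.contravariant_sequence_exact₁ (shortExact hf hfg hg) _ α rfl
    (Subsingleton.elim _ _)
  have : β = 0 := Subsingleton.elim _ _
  rw [this, Abelian.Ext.comp_zero]

/-- The connecting map from degree j is zero because every class on A lifts to B: by `hs` when j =
0, trivially when j > 0. A single degree is isolated so that induction on the degree can use it. -/
theorem subsingleton_ext_succ (hf : Function.Injective f) (hfg : Function.Exact f g)
    (hg : Function.Surjective g) (j : ℕ)
    (hA : 0 < j → Subsingleton (Abelian.Ext (ModuleCat.of R A) (ModuleCat.of R R) j))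
    (hB : Subsingleton (Abelian.Ext (ModuleCat.of R B) (ModuleCat.of R R) (1 + j)))
    (hs : ∀ φ : A →ₗ[R] R, ∃ ψ : B →ₗ[R] R, ψ ∘ₗ f = φ) :
    Subsingleton (Abelian.Ext (ModuleCat.of R C) (ModuleCat.of R R) (1 + j)) := by
  refine subsingleton_of_forall_eq 0 fun α => ?_
  obtain ⟨β, rfl⟩ := Abelian.Ext.contravariant_sequence_exact₃ (shortExact hf hfg hg) _ α
    (Subsingleton.elim _ _) rfl
  obtain ⟨γ, rfl⟩ : ∃ γ : Abelian.Ext (ModuleCat.of R B) (ModuleCat.of R R) j,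
      (Abelian.Ext.mk₀ (ModuleCat.ofHom f)).comp γ (zero_add j) = β := by
    rcases Nat.eq_zero_or_pos j with rfl | hj
    · obtain ⟨φ, rfl⟩ := (Abelian.Ext.mk₀_bijective _ _).2 β
      obtain ⟨ψ, hψ⟩ := hs φ.hom
      refine ⟨Abelian.Ext.mk₀ (ModuleCat.ofHom ψ), ?_⟩
      rw [Abelian.Ext.mk₀_comp_mk₀, ← ModuleCat.ofHom_comp, hψ]
      rfl
    · have := hA hj
      exact ⟨0, Subsingleton.elim _ _⟩
  exact (shortExact hf hfg hg).extClass_comp_assoc γ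

theorem right (hf : Function.Injective f) (hfg : Function.Exact f g)
    (hg : Function.Surjective g) (hA : ExtVanishes R A) (hB : ExtVanishes R B)
    (hs : ∀ φ : A →ₗ[R] R, ∃ ψ : B →ₗ[R] R, ψ ∘ₗ f = φ) :
    ExtVanishes R C := by
  intro i hi
  obtain ⟨j, rfl⟩ := Nat.exists_eq_add_of_le (Nat.succ_le_of_lt hi)
  exact subsingleton_ext_succ hf hfg hg j (hA j) (hB _ hi) hs

theorem exists_extend (hf : Function.Injective f) (hfg : Function.Exact f g)
    (hg : Function.Surjective g) (hC : ExtVanishes R C) (φ : A →ₗ[R] R) :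
    ∃ ψ : B →ₗ[R] R, ψ ∘ₗ f = φ := by
  have := hC 1 one_pos
  obtain ⟨β, hβ⟩ := Abelian.Ext.contravariant_sequence_exact₁ (shortExact hf hfg hg) _
    (Abelian.Ext.mk₀ (ModuleCat.ofHom φ)) rfl (Subsingleton.elim _ _)
  obtain ⟨ψ, rfl⟩ := (Abelian.Ext.mk₀_bijective _ _).2 β
  refine ⟨ψ.hom, ?_⟩
  rw [Abelian.Ext.mk₀_comp_mk₀] at hβ
  have := (Abelian.Ext.mk₀_bijective _ _).1 hβ
  exact congrArg ModuleCat.Hom.hom this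

theorem prod (hA : ExtVanishes R A) (hB : ExtVanishes R B) : ExtVanishes R (A × B) :=
  middle (f := LinearMap.inl R A B) (g := LinearMap.snd R A B) LinearMap.inl_injective
    .inl_snd Prod.snd_surjective hA hB

end ExtVanishes

/-! ### Permanence of total reflexivity. -/

namespace IsTotallyReflexive

variable {R : Type u} [CommRing R] {A B C : Type u} [AddCommGroup A] [Module R A]
  [AddCommGroup B] [Module R B] [AddCommGroup C] [Module R C]

theorem of_retract (s : A →ₗ[R] B) (p : B →ₗ[R] A) (h : p ∘ₗ s = LinearMap.id)
    (hB : IsTotallyReflexive R B) : IsTotallyReflexive R A where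
  finite := by
    have := hB.finite
    exact Module.Finite.of_surjective p fun a => ⟨s a, LinearMap.congr_fun h a⟩
  bijective_eval := by
    have : Module.IsReflexive R B := ⟨hB.bijective_eval⟩
    have := Module.IsReflexive.of_split s p h
    exact Module.bijective_dual_eval R A
  subsingleton_ext := ExtVanishes.of_retract s p h hB.subsingleton_ext
  subsingleton_ext_dual := by
    refine ExtVanishes.of_retract p.dualMap s.dualMap ?_ hB.subsingleton_ext_dual
    rw [LinearMap.dualMap_comp_dualMap, h, LinearMap.dualMap_id]

theorem of_equiv (e : A ≃ₗ[R] B) (hB : IsTotallyReflexive R B) : IsTotallyReflexive R A :=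
  hB.of_retract e.toLinearMap e.symm.toLinearMap (by ext; simp)

theorem self (R : Type u) [CommRing R] : IsTotallyReflexive R R where
  finite := inferInstance
  bijective_eval := Module.bijective_dual_eval R R
  subsingleton_ext := ExtVanishes.self R
  subsingleton_ext_dual :=
    (ExtVanishes.self R).of_equiv (LinearMap.ringLmapEquivSelf R R R)

theorem of_subsingleton [Subsingleton A] : IsTotallyReflexive R A :=
  (self R).of_retract (0 : A →ₗ[R] R) (0 : R →ₗ[R] A)
    (LinearMap.ext fun _ => Subsingleton.elim _ _)

theorem prod (hA : IsTotallyReflexive R A) (hB : IsTotallyReflexive R B) :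
    IsTotallyReflexive R (A × B) where
  finite := by
    have := hA.finite
    have := hB.finite
    infer_instance
  bijective_eval := by
    have : Module.IsReflexive R A := ⟨hA.bijective_eval⟩
    have : Module.IsReflexive R B := ⟨hB.bijective_eval⟩
    exact Module.bijective_dual_eval R (A × B)
  subsingleton_ext := ExtVanishes.prod hA.subsingleton_ext hB.subsingleton_ext
  subsingleton_ext_dual :=
    (ExtVanishes.prod hA.subsingleton_ext_dual hB.subsingleton_ext_dual).of_equiv
      (LinearMap.coprodEquiv R).symm

theorem pi (hA : IsTotallyReflexive R A) (n : ℕ) : IsTotallyReflexive R (Fin n → A) := by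
  induction n with
  | zero => exact of_subsingleton
  | succ n ih => exact (hA.prod ih).of_equiv (Fin.consLinearEquiv R fun _ => A).symm

/-- If `0 → A → B → C → 0` is exact, `A` and `B` are totally reflexive and every functional on
`A` extends to `B`, then `C` is totally reflexive. -/
theorem of_exact {f : A →ₗ[R] B} {g : B →ₗ[R] C} (hf : Function.Injective f)
    (hfg : Function.Exact f g) (hg : Function.Surjective g)
    (hA : IsTotallyReflexive R A) (hB : IsTotallyReflexive R B)
    (hs : Function.Surjective f.dualMap) : IsTotallyReflexive R C := by
  have hinj : Function.Injective g.dualMap := LinearMap.dualMap_injective_of_surjective hg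
  have hex : Function.Exact g.dualMap f.dualMap :=
    LinearMap.exact_lcomp_of_exact_of_surjective R hfg hg
  have hex2 : Function.Exact f.dualMap.dualMap g.dualMap.dualMap :=
    LinearMap.exact_lcomp_of_exact_of_surjective R hex hs
  refine ⟨?_, ?_, ?_, ?_⟩
  · have := hB.finite
    exact Module.Finite.of_surjective g hg
  -- Compare the sequence with its bidual. B** → C** is onto because Ext¹(A*, R) = 0.
  · refine LinearMap.bijective_of_surjective_of_bijective_of_right_exact f g
      f.dualMap.dualMap g.dualMap.dualMap (Module.Dual.eval R A) (Module.Dual.eval R B)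
      (Module.Dual.eval R C) rfl rfl hfg hex2 hA.bijective_eval.2 hB.bijective_eval hg ?_
    intro φ
    exact ExtVanishes.exists_extend hinj hex hs hA.subsingleton_ext_dual φ
  · exact ExtVanishes.right hf hfg hg hA.subsingleton_ext hB.subsingleton_ext hs
  · exact ExtVanishes.left hinj hex hs hB.subsingleton_ext_dual hA.subsingleton_ext_dual

end IsTotallyReflexive

/-! ### Annihilator pairs and change of rings to R/I. -/

/-- `x` generates `(0 : I)` and `I = (0 : x)`. -/
structure AnnihilatorPair {R : Type u} [CommRing R] (I : Ideal R) (x : R) : Prop where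
  mul_eq_zero_iff : ∀ r, r * x = 0 ↔ r ∈ I
  zeroColon_eq : zeroColon I = Ideal.span {x}

theorem mem_zeroColon {R : Type u} [CommRing R] {I : Ideal R} {r : R} :
    r ∈ zeroColon I ↔ ∀ s ∈ I, r * s = 0 := by
  simp [zeroColon, Submodule.mem_annihilator]

/-- Let φ generate Hom(R/I, R) ≅ R/I and put x = φ(1). The annihilator of φ is I, and evaluation at
1 identifies Hom(R/I, R) with (0 : I). -/
theorem IsQuasiGorenstein.exists_annihilatorPair {R : Type u} [CommRing R] {I : Ideal R}
    (hI : IsQuasiGorenstein I) (hgrade : idealGrade I = 0) : ∃ x, AnnihilatorPair I x := by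
  obtain ⟨e₀⟩ := hI.ext_grade 0 (by simp [hgrade])
  let e : ((R ⧸ I) →ₗ[R] R) ≃ₗ[R] (R ⧸ I) :=
    (ModuleCat.homLinearEquiv (S := R) (M := ModuleCat.of R (R ⧸ I))
      (N := ModuleCat.of R R)).symm ≪≫ₗ Abelian.Ext.linearEquiv₀.symm ≪≫ₗ e₀
  let φ := e.symm (Ideal.Quotient.mk I 1)
  have key : ∀ r : R, φ (Ideal.Quotient.mk I r) = r * φ (Ideal.Quotient.mk I 1) := fun r => by
    rw [← smul_eq_mul, ← map_smul]
    congr 1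
    simp [Algebra.smul_def]
  have hx : ∀ r, r * φ (Ideal.Quotient.mk I 1) = 0 ↔ r ∈ I := by
    intro r
    constructor
    · intro h
      have h1 : r • φ = 0 := by
        ext
        simpa using h
      have h2 : r • Ideal.Quotient.mk I 1 = 0 := by
        rw [← e.apply_symm_apply (Ideal.Quotient.mk I 1), ← map_smul]
        change e (r • φ) = 0
        rw [h1, map_zero]
      rw [← Ideal.Quotient.eq_zero_iff_mem, ← h2]
      simp [Algebra.smul_def]
    · intro h
      rw [← key, Ideal.Quotient.eq_zero_iff_mem.2 h, map_zero]
  refine ⟨φ (Ideal.Quotient.mk I 1), hx, le_antisymm ?_ ?_⟩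
  · intro y hy
    rw [mem_zeroColon] at hy
    let ψ : (R ⧸ I) →ₗ[R] R := Submodule.liftQ I (LinearMap.toSpanSingleton R R y) fun s hs => by
      simp [mul_comm s y, hy s hs]
    have hψ : ψ (Ideal.Quotient.mk I 1) = y := by
      change (1 : R) • y = y
      simp
    obtain ⟨s, hs⟩ := Ideal.Quotient.mk_surjective (e ψ)
    have : ψ = s • φ := by
      rw [← map_smul, LinearEquiv.eq_symm_apply, ← hs]
      simp [Algebra.smul_def]
    rw [Ideal.mem_span_singleton']
    exact ⟨s, by rw [← hψ, this]; rfl⟩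
  · rw [Ideal.span_singleton_le_iff_mem, mem_zeroColon]
    intro s hs
    rw [mul_comm, (hx s).2 hs]

namespace AnnihilatorPair

variable {R : Type u} [CommRing R] {I : Ideal R} {x : R}

/-- Multiplication by `x`, as a map `R/I → R`. -/
def mulMap (h : AnnihilatorPair I x) : (R ⧸ I) →ₗ[R] R :=
  Submodule.liftQ I (LinearMap.toSpanSingleton R R x) fun s hs => by
    simp [(h.mul_eq_zero_iff s).2 hs]

theorem mulMap_injective (h : AnnihilatorPair I x) : Function.Injective h.mulMap := by
  rw [injective_iff_map_eq_zero]
  intro s hs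
  obtain ⟨r, rfl⟩ := Ideal.Quotient.mk_surjective s
  exact Ideal.Quotient.eq_zero_iff_mem.2 ((h.mul_eq_zero_iff r).1 hs)

theorem mem_range_mulMap (h : AnnihilatorPair I x) {y : R} (hy : ∀ s ∈ I, s * y = 0) :
    y ∈ LinearMap.range h.mulMap := by
  have : y ∈ zeroColon I := mem_zeroColon.2 fun s hs => by rw [mul_comm, hy s hs]
  rw [h.zeroColon_eq, Ideal.mem_span_singleton'] at this
  obtain ⟨r, rfl⟩ := this
  exact ⟨Ideal.Quotient.mk I r, rfl⟩

variable {Y Z : Type u} [AddCommGroup Y] [Module R Y] [Module (R ⧸ I) Y]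
  [IsScalarTower R (R ⧸ I) Y] [AddCommGroup Z] [Module R Z] [Module (R ⧸ I) Z]
  [IsScalarTower R (R ⧸ I) Z]

/-- For an `R/I`-module `Y`, functionals over `R/I` and over `R` correspond. -/
noncomputable def dualMapHom (h : AnnihilatorPair I x) (Y : Type u) [AddCommGroup Y]
    [Module R Y] [Module (R ⧸ I) Y] [IsScalarTower R (R ⧸ I) Y] :
    Module.Dual (R ⧸ I) Y →ₗ[R] Module.Dual R Y where
  toFun f := h.mulMap ∘ₗ f.restrictScalars R
  map_add' f g := by ext; simp
  map_smul' r f := by ext; simp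

theorem dualMapHom_apply (h : AnnihilatorPair I x) (f : Module.Dual (R ⧸ I) Y) (y : Y) :
    h.dualMapHom Y f y = h.mulMap (f y) := rfl

theorem smul_eq_zero_of_mem {s : R} (hs : s ∈ I) (y : Y) : s • y = 0 := by
  rw [← algebraMap_smul (R ⧸ I) s y, Ideal.Quotient.algebraMap_eq,
    Ideal.Quotient.eq_zero_iff_mem.2 hs, zero_smul]

/-- An R-functional on a module killed by I takes values in (0 : I) = xR, which is a copy of R/I. -/
theorem dualMapHom_bijective (h : AnnihilatorPair I x) :
    Function.Bijective (h.dualMapHom Y) := by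
  constructor
  · intro f g hfg
    ext y
    exact h.mulMap_injective (LinearMap.congr_fun hfg y)
  · intro k
    let k' : Y →ₗ[R] LinearMap.range h.mulMap := k.codRestrict _ fun y =>
      h.mem_range_mulMap fun s hs => by
        rw [← smul_eq_mul, ← map_smul, smul_eq_zero_of_mem hs, map_zero]
    refine ⟨((LinearEquiv.ofInjective _ h.mulMap_injective).symm.toLinearMap ∘ₗ
      k').extendScalarsOfSurjective Ideal.Quotient.mk_surjective, ?_⟩
    ext y
    rw [dualMapHom_apply]
    exact congrArg Subtype.val
      ((LinearEquiv.ofInjective _ h.mulMap_injective).apply_symm_apply (k' y))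

/-- `dualMapHom` as an isomorphism. -/
noncomputable def dualEquiv (h : AnnihilatorPair I x) (Y : Type u) [AddCommGroup Y]
    [Module R Y] [Module (R ⧸ I) Y] [IsScalarTower R (R ⧸ I) Y] :
    Module.Dual (R ⧸ I) Y ≃ₗ[R] Module.Dual R Y :=
  LinearEquiv.ofBijective _ h.dualMapHom_bijective

theorem dualEquiv_apply (h : AnnihilatorPair I x) (f : Module.Dual (R ⧸ I) Y) (y : Y) :
    h.dualEquiv Y f y = h.mulMap (f y) := rfl

/-- Biduality over `R` and over `R/I` agree. -/
theorem bijective_eval_iff (h : AnnihilatorPair I x) :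
    Function.Bijective (Module.Dual.eval (R ⧸ I) Y) ↔
      Function.Bijective (Module.Dual.eval R Y) := by
  let e : Module.Dual (R ⧸ I) (Module.Dual (R ⧸ I) Y) ≃ₗ[R]
      Module.Dual R (Module.Dual R Y) :=
    h.dualEquiv (Module.Dual (R ⧸ I) Y) ≪≫ₗ (h.dualEquiv Y).symm.dualMap
  have : ⇑(Module.Dual.eval R Y) = e ∘ Module.Dual.eval (R ⧸ I) Y := by
    funext y
    ext f
    obtain ⟨f, rfl⟩ := (h.dualEquiv Y).surjective f
    simp [e, dualEquiv_apply]
  rw [this, e.bijective.of_comp_iff']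

theorem isTotallyReflexive_quotient (h : AnnihilatorPair I x)
    (hv : ExtVanishes R (R ⧸ I)) : IsTotallyReflexive R (R ⧸ I) where
  finite := inferInstance
  bijective_eval := h.bijective_eval_iff.1 (Module.bijective_dual_eval (R ⧸ I) (R ⧸ I))
  subsingleton_ext := hv
  subsingleton_ext_dual := hv.of_equiv ((h.dualEquiv (R ⧸ I)).symm ≪≫ₗ
    (LinearMap.ringLmapEquivSelf (R ⧸ I) R (R ⧸ I)))

theorem exists_extend_quotient (h : AnnihilatorPair I x) (f : Y →ₗ[R ⧸ I] Z)
    (hs : ∀ φ : Y →ₗ[R] R, ∃ ψ : Z →ₗ[R] R, ψ ∘ₗ f.restrictScalars R = φ)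
    (φ : Y →ₗ[R ⧸ I] (R ⧸ I)) : ∃ ψ : Z →ₗ[R ⧸ I] (R ⧸ I), ψ ∘ₗ f = φ := by
  obtain ⟨ψ, hψ⟩ := hs (h.dualEquiv Y φ)
  obtain ⟨ψ, rfl⟩ := (h.dualEquiv Z).surjective ψ
  refine ⟨ψ, ?_⟩
  ext y
  exact h.mulMap_injective (LinearMap.congr_fun hψ y)

/-- Dimension shifting along a free R/I-cover of Y. Its terms are Ext-acyclic over R, hence so is
the syzygy, and Ext¹_R(Y, R) = 0 extends functionals from the syzygy to the cover; `dualEquiv`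
carries this extension to R/I. -/
theorem extVanishes_quotient [IsNoetherianRing R] (h : AnnihilatorPair I x)
    (hv : ExtVanishes R (R ⧸ I)) [Module.Finite (R ⧸ I) Y]
    (hY : ExtVanishes R Y) : ExtVanishes (R ⧸ I) Y := by
  intro i hi
  obtain ⟨j, rfl⟩ := Nat.exists_eq_add_of_le (Nat.succ_le_of_lt hi)
  clear hi
  induction j using Nat.strong_induction_on generalizing Y with
  | _ j ih =>
    obtain ⟨n, g, hg⟩ := Module.Finite.exists_fin' (R ⧸ I) Y
    have hF : ExtVanishes R (Fin n → R ⧸ I) :=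
      ((h.isTotallyReflexive_quotient hv).pi n).subsingleton_ext
    have hex : Function.Exact (LinearMap.ker g).subtype g := LinearMap.exact_subtype_ker_map g
    have hinj : Function.Injective (LinearMap.ker g).subtype := Subtype.val_injective
    have hs := ExtVanishes.exists_extend (f := (LinearMap.ker g).subtype.restrictScalars R)
      (g := g.restrictScalars R) hinj hex hg hY
    have hZ : ExtVanishes R (LinearMap.ker g) :=
      ExtVanishes.left (f := (LinearMap.ker g).subtype.restrictScalars R)
        (g := g.restrictScalars R) hinj hex hg hF hY
    refine ExtVanishes.subsingleton_ext_succ hinj hex hg j (fun hj => ?_)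
      (((IsTotallyReflexive.self (R ⧸ I)).pi n).subsingleton_ext _ (by omega))
      (h.exists_extend_quotient _ hs)
    obtain ⟨k, rfl⟩ := Nat.exists_eq_add_of_le (Nat.succ_le_of_lt hj)
    exact ih k (by omega) hZ

theorem isTotallyReflexive_of_tower [IsNoetherianRing R] (h : AnnihilatorPair I x)
    (hv : ExtVanishes R (R ⧸ I)) (hY : IsTotallyReflexive R Y) :
    IsTotallyReflexive (R ⧸ I) Y := by
  have := hY.finite
  have : Module.Finite (R ⧸ I) Y := Module.Finite.of_restrictScalars_finite R _ _
  exact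
    { finite := this
      bijective_eval := h.bijective_eval_iff.2 hY.bijective_eval
      subsingleton_ext := h.extVanishes_quotient hv hY.subsingleton_ext
      subsingleton_ext_dual := h.extVanishes_quotient hv
        (ExtVanishes.of_equiv (h.dualEquiv Y) hY.subsingleton_ext_dual) }

end AnnihilatorPair

/-- The quotient of `R × (R/I)ⁿ` by the cyclic submodule generated by `(x, a)`. -/
abbrev ExtensionModule {R : Type u} [CommRing R] (I : Ideal R) (x : R) {n : ℕ} (a : Fin n → R) :
    Type u :=
  (R × (Fin n → R ⧸ I)) ⧸
    Submodule.span R {((x, fun i => Ideal.Quotient.mk I (a i)) : R × (Fin n → R ⧸ I))}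

/-! ### Maps from free modules onto powers of R/L. -/

section QuotientPower

variable {R : Type u} [CommRing R] {L : Ideal R} {p q : ℕ}

/-- An `R`-linear map `Rᵖ → (R/L)^q` factors through `(R/L)ᵖ`. -/
theorem exists_factor_quotient (g : (Fin p → R) →ₗ[R] (Fin q → R ⧸ L)) :
    ∃ T : (Fin p → R ⧸ L) →ₗ[R ⧸ L] (Fin q → R ⧸ L),
      ∀ w : Fin p → R, T (fun i => Ideal.Quotient.mk L (w i)) = g w := by
  refine ⟨Fintype.linearCombination (R ⧸ L) fun i => g (Pi.single i 1), fun w => ?_⟩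
  have : w = ∑ i, w i • (Pi.single i 1 : Fin p → R) := by
    ext j
    simp [Finset.sum_apply, Pi.single_apply]
  conv_rhs => rw [this, map_sum]
  simp only [map_smul, Fintype.linearCombination_apply]
  rfl

theorem le_of_surjective_quotient (hL : L ≠ ⊤) (g : (Fin p → R) →ₗ[R] (Fin q → R ⧸ L))
    (hg : Function.Surjective g) : q ≤ p := by
  obtain ⟨T, hT⟩ := exists_factor_quotient g
  have : Nontrivial (R ⧸ L) := Ideal.Quotient.nontrivial_iff.2 hL
  refine le_of_fin_surjective (R ⧸ L) T fun y => ?_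
  obtain ⟨w, rfl⟩ := hg y
  exact ⟨_, hT w⟩

/-- The induced surjective endomorphism of the finite module (R/L)ᵖ is injective. -/
theorem mem_of_surjective_quotient (g : (Fin p → R) →ₗ[R] (Fin p → R ⧸ L))
    (hg : Function.Surjective g) {w : Fin p → R} (hw : g w = 0) (i : Fin p) : w i ∈ L := by
  obtain ⟨T, hT⟩ := exists_factor_quotient g
  have hinj := OrzechProperty.injective_of_surjective_endomorphism T fun y => by
    obtain ⟨w, rfl⟩ := hg y
    exact ⟨_, hT w⟩
  exact Ideal.Quotient.eq_zero_iff_mem.1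
    (congrFun ((injective_iff_map_eq_zero T).1 hinj _ ((hT w).trans hw)) i)

end QuotientPower

/-! ### The extension modules: exact sequence, total reflexivity, invariants. -/

namespace ExtensionModule

variable {R : Type u} [CommRing R] (I : Ideal R) (x : R) {n : ℕ} (a : Fin n → R)

/-- The inclusion `(R/I)ⁿ → M`. -/
def incl : (Fin n → R ⧸ I) →ₗ[R] ExtensionModule I x a :=
  Submodule.mkQ _ ∘ₗ LinearMap.inr R R (Fin n → R ⧸ I)

/-- The canonical surjection `Rⁿ⁺¹ → M`. -/
def cover : (Fin (n + 1) → R) →ₗ[R] ExtensionModule I x a :=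
  Submodule.mkQ _ ∘ₗ (LinearMap.id.prodMap (I.mkQ.compLeft (Fin n)) ∘ₗ
    (Fin.consLinearEquiv R fun _ : Fin (n + 1) => R).symm.toLinearMap)

theorem cover_cons (r : R) (v : Fin n → R) : cover I x a (Fin.cons r v) =
    Submodule.Quotient.mk (r, fun i => Ideal.Quotient.mk I (v i)) := rfl

theorem cover_surjective : Function.Surjective (cover I x a) := by
  intro m
  obtain ⟨⟨r, v⟩, rfl⟩ := Submodule.Quotient.mk_surjective _ m
  choose w hw using fun i => Ideal.Quotient.mk_surjective (v i)
  exact ⟨Fin.cons r w, by rw [cover_cons, funext hw]⟩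

theorem cover_relation : cover I x a (Fin.cons x a) = 0 :=
  (Submodule.Quotient.mk_eq_zero _).2 (Submodule.mem_span_singleton_self _)

theorem mem_span_relation {p : R × (Fin n → R ⧸ I)} :
    p ∈ Submodule.span R {((x, fun i => Ideal.Quotient.mk I (a i)) : R × (Fin n → R ⧸ I))} ↔
      ∃ r : R, r * x = p.1 ∧ ∀ i, Ideal.Quotient.mk I (r * a i) = p.2 i := by
  rw [Submodule.mem_span_singleton]
  refine exists_congr fun r => ?_
  rw [Prod.ext_iff, funext_iff]
  rfl

variable {I x}

/-- The projection `M → R/(0 : I)`. -/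
def proj (h : AnnihilatorPair I x) : ExtensionModule I x a →ₗ[R] R ⧸ zeroColon I :=
  Submodule.liftQ _ ((zeroColon I).mkQ ∘ₗ LinearMap.fst R R (Fin n → R ⧸ I)) <| by
    rw [Submodule.span_singleton_le_iff_mem, LinearMap.mem_ker]
    refine (Submodule.Quotient.mk_eq_zero _).2 ?_
    rw [h.zeroColon_eq]
    exact Ideal.mem_span_singleton_self x

theorem proj_mk (h : AnnihilatorPair I x) (r : R) (v : Fin n → R ⧸ I) :
    proj a h (Submodule.Quotient.mk (r, v)) = Ideal.Quotient.mk _ r := rfl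

theorem proj_surjective (h : AnnihilatorPair I x) : Function.Surjective (proj a h) := fun s => by
  obtain ⟨r, rfl⟩ := Ideal.Quotient.mk_surjective s
  exact ⟨Submodule.Quotient.mk (r, 0), rfl⟩

theorem incl_injective (h : AnnihilatorPair I x) : Function.Injective (incl I x a) := by
  rw [injective_iff_map_eq_zero]
  intro v hv
  obtain ⟨r, hr, hv⟩ := (mem_span_relation I x a).1 ((Submodule.Quotient.mk_eq_zero _).1 hv)
  funext i
  refine (hv i).symm.trans (Ideal.Quotient.eq_zero_iff_mem.2 ?_)
  exact I.mul_mem_right _ ((h.mul_eq_zero_iff r).1 hr)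

theorem exact_incl_proj (h : AnnihilatorPair I x) :
    Function.Exact (incl I x a) (proj a h) := by
  intro m
  obtain ⟨⟨r, v⟩, rfl⟩ := Submodule.Quotient.mk_surjective _ m
  rw [proj_mk, Ideal.Quotient.eq_zero_iff_mem, h.zeroColon_eq, Ideal.mem_span_singleton']
  constructor
  · rintro ⟨s, rfl⟩
    refine ⟨v - fun i => Ideal.Quotient.mk I (s * a i), (Submodule.Quotient.eq _).2 ?_⟩
    refine (mem_span_relation I x a).2 ⟨-s, by simp, fun i => ?_⟩
    simp
  · rintro ⟨w, hw⟩
    obtain ⟨s, hs, -⟩ := (mem_span_relation I x a).1 ((Submodule.Quotient.eq _).1 hw)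
    exact ⟨-s, by simp at hs; simp [hs]⟩

theorem isTotallyReflexive (h : AnnihilatorPair I x) (hv : ExtVanishes R (R ⧸ I)) :
    IsTotallyReflexive R (ExtensionModule I x a) := by
  have hQ := h.isTotallyReflexive_quotient hv
  let f : (R ⧸ I) →ₗ[R] R × (Fin n → R ⧸ I) := h.mulMap.prod
    (LinearMap.pi fun i => LinearMap.mulRight R (Ideal.Quotient.mk I (a i)))
  refine IsTotallyReflexive.of_exact (f := f) (g := Submodule.mkQ _) ?_ ?_
    (Submodule.mkQ_surjective _) hQ ((IsTotallyReflexive.self R).prod (hQ.pi n)) ?_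
  · intro s t hst
    exact h.mulMap_injective (congrArg Prod.fst hst)
  · intro p
    rw [Submodule.mkQ_apply, Submodule.Quotient.mk_eq_zero, mem_span_relation]
    constructor
    · rintro ⟨r, hr, hp⟩
      exact ⟨Ideal.Quotient.mk I r, Prod.ext hr (funext hp)⟩
    · rintro ⟨s, rfl⟩
      obtain ⟨r, rfl⟩ := Ideal.Quotient.mk_surjective s
      exact ⟨r, rfl, fun i => rfl⟩
  · intro φ
    obtain ⟨k, rfl⟩ := (h.dualEquiv (R ⧸ I)).surjective φ
    obtain ⟨r, hr⟩ := Ideal.Quotient.mk_surjective (k 1)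
    -- Every functional on R/I is r times multiplication by x, and the R-coordinate of f is
    -- multiplication by x.
    refine ⟨r • LinearMap.fst R R _, LinearMap.ext fun s => ?_⟩
    have : k s = r • s := by
      rw [← mul_one s, ← smul_eq_mul, map_smul, ← hr, smul_eq_mul, smul_eq_mul, mul_one,
        Algebra.smul_def, mul_comm]
      rfl
    rw [AnnihilatorPair.dualEquiv_apply, this, map_smul, map_smul]
    rfl

variable {a}

theorem le_of_surjective {L : Ideal R} {p : ℕ} (hL : L ≠ ⊤)
    (G : ExtensionModule I x a →ₗ[R] (Fin p → R ⧸ L)) (hG : Function.Surjective G) :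
    p ≤ n + 1 :=
  le_of_surjective_quotient hL (G ∘ₗ cover I x a) (hG.comp (cover_surjective I x a))

theorem mem_of_surjective {L : Ideal R}
    (G : ExtensionModule I x a →ₗ[R] (Fin (n + 1) → R ⧸ L)) (hG : Function.Surjective G)
    (i : Fin n) : a i ∈ L :=
  mem_of_surjective_quotient (G ∘ₗ cover I x a) (hG.comp (cover_surjective I x a))
    (w := Fin.cons x a) (by rw [LinearMap.comp_apply, cover_relation, map_zero]) i.succ

theorem exists_surjective {L : Ideal R} (hI : I ≤ L) (hx : x ∈ L) (ha : ∀ i, a i ∈ L) :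
    ∃ G : ExtensionModule I x a →ₗ[R] (Fin (n + 1) → R ⧸ L), Function.Surjective G := by
  let q : (R ⧸ I) →ₗ[R] R ⧸ L := Submodule.factor hI
  let F : (R × (Fin n → R ⧸ I)) →ₗ[R] ((R ⧸ L) × (Fin n → R ⧸ L)) :=
    L.mkQ.prodMap (q.compLeft (Fin n))
  have hF : Function.Surjective F := by
    rintro ⟨r, v⟩
    obtain ⟨r, rfl⟩ := Ideal.Quotient.mk_surjective r
    choose w hw using fun i => Ideal.Quotient.mk_surjective (v i)
    exact ⟨(r, fun i => Ideal.Quotient.mk I (w i)), Prod.ext rfl (funext hw)⟩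
  refine ⟨(Fin.consLinearEquiv R fun _ : Fin (n + 1) => R ⧸ L).toLinearMap ∘ₗ
    Submodule.liftQ _ F ?_,
    (Fin.consLinearEquiv R fun _ : Fin (n + 1) => R ⧸ L).surjective.comp ?_⟩
  · rw [Submodule.span_singleton_le_iff_mem, LinearMap.mem_ker]
    exact Prod.ext (Ideal.Quotient.eq_zero_iff_mem.2 hx)
      (funext fun i => Ideal.Quotient.eq_zero_iff_mem.2 (ha i))
  · intro y
    obtain ⟨p, rfl⟩ := hF y
    exact ⟨Submodule.Quotient.mk p, rfl⟩

/-- The ideal on the right is one modulo which the module of b maps onto a free module of rank n +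
1; the isomorphism transfers this to the module of a. -/
theorem mem_of_linearEquiv {b : Fin n → R}
    (e : ExtensionModule I x a ≃ₗ[R] ExtensionModule I x b) (i : Fin n) :
    a i ∈ I ⊔ Ideal.span {x} ⊔ Ideal.span (Set.range b) := by
  have hI : I ≤ I ⊔ Ideal.span {x} ⊔ Ideal.span (Set.range b) := le_sup_left.trans le_sup_left
  have hx : x ∈ I ⊔ Ideal.span {x} ⊔ Ideal.span (Set.range b) :=
    Ideal.mem_sup_left (Ideal.mem_sup_right (Ideal.mem_span_singleton_self x))
  obtain ⟨G, hG⟩ := exists_surjective (a := b) hI hx fun i =>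
    Ideal.mem_sup_right (Ideal.subset_span ⟨i, rfl⟩)
  exact mem_of_surjective (G ∘ₗ e.toLinearMap) (hG.comp e.surjective) i

section Local

variable [IsLocalRing R]

open IsLocalRing

theorem le_of_linearEquiv {m : ℕ} {b : Fin m → R} (hI : I ≤ maximalIdeal R)
    (hx : x ∈ maximalIdeal R) (hb : ∀ i, b i ∈ maximalIdeal R)
    (e : ExtensionModule I x a ≃ₗ[R] ExtensionModule I x b) : m ≤ n := by
  obtain ⟨G, hG⟩ := exists_surjective hI hx hb
  exact Nat.le_of_succ_le_succ (le_of_surjective (maximalIdeal.isMaximal R).ne_top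
    (G ∘ₗ e.toLinearMap) (hG.comp e.surjective))

/-- Freeness would force rank n + 1, making `cover` a surjective endomorphism of Rⁿ⁺¹, hence
injective; but it kills (x, a) with x ≠ 0. -/
theorem not_free [IsNoetherianRing R] (hI : I ≤ maximalIdeal R) (hx : x ∈ maximalIdeal R)
    (hx0 : x ≠ 0) (ha : ∀ i, a i ∈ maximalIdeal R) :
    ¬ Module.Free R (ExtensionModule I x a) := by
  intro hfree
  obtain ⟨p, ⟨e⟩⟩ : ∃ p, Nonempty (ExtensionModule I x a ≃ₗ[R] (Fin p → R)) :=
    ⟨_, ⟨(Module.finBasis R (ExtensionModule I x a)).equivFun⟩⟩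
  have hle : p ≤ n + 1 := le_of_surjective (maximalIdeal.isMaximal R).ne_top
    ((maximalIdeal R).mkQ.compLeft (Fin p) ∘ₗ e.toLinearMap)
    ((show Function.Surjective ((maximalIdeal R).mkQ.compLeft (Fin p)) from
      (Submodule.mkQ_surjective _).comp_left).comp e.surjective)
  obtain ⟨G, hG⟩ := exists_surjective hI hx ha
  have hge : n + 1 ≤ p := le_of_surjective_quotient (maximalIdeal.isMaximal R).ne_top
    (G ∘ₗ e.symm.toLinearMap) (hG.comp e.symm.surjective)
  obtain rfl : p = n + 1 := le_antisymm hle hge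
  have hinj := OrzechProperty.injective_of_surjective_endomorphism
    (e.toLinearMap ∘ₗ cover I x a) (e.surjective.comp (cover_surjective I x a))
  exact hx0 (congrFun ((injective_iff_map_eq_zero _).1 hinj (Fin.cons x a) (by
    rw [LinearMap.comp_apply, cover_relation, map_zero])) 0)

end Local

end ExtensionModule

/-! ### Minimal families modulo an ideal and their twists. -/

open IsLocalRing in
/-- Every relation among the `c i` modulo `L` has its coefficients in the maximal ideal. -/
def IsMinimalModulo {R : Type u} [CommRing R] [IsLocalRing R] (L : Ideal R) {n : ℕ}
    (c : Fin n → R) : Prop :=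
  ∀ d : Fin n → R, ∑ i, d i * c i ∈ L → ∀ i, d i ∈ maximalIdeal R

/-- Lift n + 1 members of a minimal generating set: a relation with a unit coefficient would make
one generator redundant. -/
theorem exists_isMinimalModulo {R : Type u} [CommRing R] [IsNoetherianRing R] [IsLocalRing R]
    (L : Ideal R) {n : ℕ} (hn : (n : ℕ∞) < supGenerators L) :
    ∃ c : Fin (n + 1) → R, IsMinimalModulo L c := by
  obtain ⟨𝔞, h𝔞⟩ := lt_iSup_iff.1 hn
  have hlt : n + 1 ≤ 𝔞.spanFinrank := by exact_mod_cast h𝔞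
  have hfg : Submodule.FG 𝔞 := IsNoetherian.noetherian 𝔞
  obtain ⟨s, hs, hspan⟩ := hfg.exists_span_finset_card_eq_spanFinrank
  obtain ⟨t, hts, ht⟩ := Finset.exists_subset_card_eq (hs ▸ hlt)
  let e := t.equivFinOfCardEq ht
  choose c hc using fun i => Ideal.Quotient.mk_surjective (e.symm i : R ⧸ L)
  refine ⟨c, fun d hd j => ?_⟩
  by_contra hj
  have hu : IsUnit (d j) := by simpa using hj
  classical
  let y : R ⧸ L := e.symm j
  have hyt : y ∈ t := (e.symm j).2
  have hy : y ∈ Submodule.span (R ⧸ L) (s.erase y : Set (R ⧸ L)) := by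
    have h0 : ∑ i, Ideal.Quotient.mk L (d i) * (e.symm i : R ⧸ L) = 0 := by
      simpa [hc] using Ideal.Quotient.eq_zero_iff_mem.2 hd
    rw [← Finset.add_sum_erase _ _ (Finset.mem_univ j)] at h0
    have h1 : Ideal.Quotient.mk L (d j) * y ∈
        Submodule.span (R ⧸ L) (s.erase y : Set (R ⧸ L)) := by
      rw [eq_neg_of_add_eq_zero_left h0]
      refine neg_mem (sum_mem fun i hi => ?_)
      refine Submodule.smul_mem _ _ (Submodule.subset_span ?_)
      rw [Finset.mem_coe, Finset.mem_erase]
      refine ⟨fun h => (Finset.mem_erase.1 hi).1 ?_, hts (e.symm i).2⟩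
      exact e.symm.injective (Subtype.ext h)
    have hu' : IsUnit (Ideal.Quotient.mk L (d j)) := hu.map _
    obtain ⟨w, hw⟩ := hu'.exists_left_inv
    have := Submodule.smul_mem _ w h1
    rwa [smul_eq_mul, ← mul_assoc, hw, one_mul] at this
  have hle : 𝔞.spanFinrank ≤ (s.erase y).card := by
    have : 𝔞 = Submodule.span (R ⧸ L) (s.erase y : Set (R ⧸ L)) := by
      rw [← hspan]
      refine le_antisymm (Submodule.span_le.2 fun z hz => ?_)
        (Submodule.span_mono (by simp))
      by_cases hzy : z = y
      · exact hzy ▸ hy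
      · exact Submodule.subset_span (by simpa [hzy] using hz)
    rw [this, ← Set.ncard_coe_finset]
    exact Submodule.spanFinrank_span_le_ncard_of_finite (s.erase y).finite_toSet
  have := Finset.card_erase_lt_of_mem (hts hyt)
  omega

/-- The family `c₁ + u c₀, c₂, …, cₙ`. -/
def twist {R : Type u} [CommRing R] {n : ℕ} (c : Fin (n + 1) → R) (u : R) (i : Fin n) : R :=
  c i.succ + if i.val = 0 then u * c 0 else 0

theorem sum_twist {R : Type u} [CommRing R] {n : ℕ} (c : Fin (n + 2) → R) (u : R) (d : Fin (n + 1) → R) :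
    ∑ i, d i * twist c u i = d 0 * u * c 0 + ∑ i, d i * c i.succ := by
  simp only [twist, mul_add, Finset.sum_add_distrib]
  rw [add_comm]
  congr 1
  rw [Fin.sum_univ_succ]
  simp [mul_assoc]

namespace IsMinimalModulo

open IsLocalRing

variable {R : Type u} [CommRing R] [IsLocalRing R] {L : Ideal R} {n : ℕ}

theorem mem_maximalIdeal {c : Fin (n + 1) → R} (hc : IsMinimalModulo L c) (hn : 0 < n)
    (j : Fin (n + 1)) : c j ∈ maximalIdeal R := by
  have : Nontrivial (Fin (n + 1)) := Fin.nontrivial_iff_two_le.2 (by omega)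
  obtain ⟨k, hk⟩ := exists_ne j
  -- The Koszul relation between c j and c k, read at its coefficient of c k.
  have := hc (fun i => if i = j then c k else if i = k then - c j else 0) (by
    rw [← Finset.add_sum_erase _ _ (Finset.mem_univ j),
      ← Finset.add_sum_erase _ _ (Finset.mem_erase.2 ⟨hk, Finset.mem_univ k⟩),
      Finset.sum_eq_zero]
    · convert L.zero_mem using 1
      simp [hk]
      ring
    · intro i hi
      simp only [Finset.mem_erase] at hi
      simp [hi.1, hi.2.1]) k
  simpa [hk] using this

theorem twist_isMinimalModulo {c : Fin (n + 1) → R} (hc : IsMinimalModulo L c) (u : R) :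
    IsMinimalModulo L (twist c u) := by
  intro d hd j
  obtain _ | n := n
  · exact j.elim0
  rw [sum_twist] at hd
  have := hc (Fin.cons (d 0 * u) d) (by rwa [Fin.sum_univ_succ]) j.succ
  simpa using this

theorem twist_mem_maximalIdeal {c : Fin (n + 1) → R} (hc : IsMinimalModulo L c) (hn : 0 < n)
    (u : R) (i : Fin n) : twist c u i ∈ maximalIdeal R := by
  refine add_mem (hc.mem_maximalIdeal hn _) ?_
  split_ifs
  · exact Ideal.mul_mem_left _ _ (hc.mem_maximalIdeal hn _)
  · exact zero_mem _

theorem sub_mem_of_twist_mem {c : Fin (n + 1) → R} (hc : IsMinimalModulo L c) (hn : 0 < n)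
    {u v : R} (h : ∀ i, twist c u i ∈ L ⊔ Ideal.span (Set.range (twist c v))) :
    u - v ∈ maximalIdeal R := by
  obtain _ | n := n
  · omega
  obtain ⟨l, hl, w, hw, hlw⟩ := Submodule.mem_sup.1 (h 0)
  obtain ⟨d, rfl⟩ := Ideal.mem_span_range_iff_exists_fun.1 hw
  rw [sum_twist] at hlw
  -- Collect coefficients of the c's: c₀ receives u - d₀v and c₁ receives 1 - d₀.
  have key := hc (Fin.cons (u - d 0 * v) (Pi.single 0 1 - d)) (by
    rw [Fin.sum_univ_succ]
    convert hl using 1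
    simp only [Fin.cons_zero, Fin.cons_succ, Pi.sub_apply, sub_mul, Finset.sum_sub_distrib]
    have h1 : ∑ i : Fin (n + 1), (Pi.single 0 1 : Fin (n + 1) → R) i * c i.succ =
        c (Fin.succ 0) := by
      simp [Pi.single_apply]
    rw [h1, eq_sub_of_add_eq hlw]
    simp only [twist, Fin.val_zero, if_true]
    ring)
  have h0 : u - d 0 * v ∈ maximalIdeal R := by simpa using key 0
  have h1 : 1 - d 0 ∈ maximalIdeal R := by simpa using key (Fin.succ 0)
  have : u - v = (u - d 0 * v) - (1 - d 0) * v := by ring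
  rw [this]
  exact sub_mem h0 (Ideal.mul_mem_right _ _ h1)

end IsMinimalModulo

/-! ### Indecomposability. -/

namespace ExtensionModule

open IsLocalRing

variable {R : Type u} [CommRing R] {I : Ideal R} {x : R} {n : ℕ} {a : Fin n → R}

/-- No homomorphism `M → R/I` maps the submodule `(R/I)ⁿ` onto `R/I`. -/
theorem not_surjective_comp_incl [IsLocalRing R] (h : AnnihilatorPair I x) (hI : I ≠ ⊤)
    (ha : IsMinimalModulo (I ⊔ zeroColon I) a)
    (φ : ExtensionModule I x a →ₗ[R] R ⧸ I) :
    ¬ Function.Surjective (φ ∘ₗ incl I x a) := by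
  intro hφ
  choose d hd using fun i : Fin n => Ideal.Quotient.mk_surjective
    (φ (incl I x a (Pi.single i 1)))
  have hcomp : ∀ w : Fin n → R, φ (incl I x a fun i => Ideal.Quotient.mk I (w i)) =
      Ideal.Quotient.mk I (∑ i, d i * w i) := by
    intro w
    have hw : (fun i => Ideal.Quotient.mk I (w i)) =
        ∑ i, w i • (Pi.single i 1 : Fin n → R ⧸ I) := by
      ext j
      simp [Finset.sum_apply, Pi.single_apply, Algebra.smul_def]
    rw [hw, map_sum, map_sum, map_sum]
    refine Finset.sum_congr rfl fun i _ => ?_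
    rw [map_smul, map_smul, ← hd, map_mul, Algebra.smul_def, mul_comm]
    rfl
  obtain ⟨c, hc⟩ := Ideal.Quotient.mk_surjective (φ (Submodule.Quotient.mk (1, 0)))
  have hrel : x • (Submodule.Quotient.mk (1, 0) : ExtensionModule I x a) +
      incl I x a (fun i => Ideal.Quotient.mk I (a i)) = 0 := by
    refine (Submodule.Quotient.mk_eq_zero _).2 ?_
    refine (mem_span_relation I x a).2 ⟨1, ?_, fun i => ?_⟩ <;> simp
  -- Apply φ to the defining relation; its x-term lands in (0 : I).
  have hsum : ∑ i, d i * a i ∈ I ⊔ zeroColon I := by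
    have h0 := congrArg φ hrel
    rw [map_add, map_smul, map_zero, hcomp, ← hc] at h0
    have h1 : x * c + ∑ i, d i * a i ∈ I := by
      rw [← Ideal.Quotient.eq_zero_iff_mem, ← h0, map_add, map_mul, Algebra.smul_def]
      rfl
    have h2 : x * c ∈ zeroColon I := by
      rw [h.zeroColon_eq]
      exact Ideal.mul_mem_right _ _ (Ideal.mem_span_singleton_self x)
    rw [← add_sub_cancel_left (x * c) (∑ i, d i * a i)]
    exact sub_mem (Ideal.mem_sup_left h1) (Ideal.mem_sup_right h2)
  have hdm := ha d hsum
  obtain ⟨v, hv⟩ := hφ 1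
  choose w hw using fun i => Ideal.Quotient.mk_surjective (v i)
  obtain rfl : (fun i => Ideal.Quotient.mk I (w i)) = v := funext hw
  rw [LinearMap.comp_apply, hcomp, ← map_one (Ideal.Quotient.mk I), Ideal.Quotient.eq] at hv
  have h1 : (1 : R) ∈ maximalIdeal R := by
    have := sub_mem (sum_mem fun i (_ : i ∈ Finset.univ) =>
      Ideal.mul_mem_right (w i) _ (hdm i)) (le_maximalIdeal hI hv)
    rwa [sub_sub_cancel] at this
  exact (Ideal.ne_top_iff_one _).1 (maximalIdeal.isMaximal R).ne_top h1

/-- If `(0 : I²) = (0 : I)`, then there are no nonzero homomorphisms `(R/I)ⁿ → R/(0 : I)`. -/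
theorem hom_eq_zero (hI2 : zeroColon (I ^ 2) = zeroColon I)
    (w : (Fin n → R ⧸ I) →ₗ[R] R ⧸ zeroColon I) : w = 0 := by
  refine LinearMap.ext fun v => ?_
  obtain ⟨r, hr⟩ := Ideal.Quotient.mk_surjective (w v)
  rw [← hr, LinearMap.zero_apply, Ideal.Quotient.eq_zero_iff_mem, ← hI2, mem_zeroColon]
  -- I kills the source, so Ir ⊆ (0 : I); thus I²r = 0.
  have hs : ∀ s ∈ I, s * r ∈ zeroColon I := by
    intro s hs
    rw [← Ideal.Quotient.eq_zero_iff_mem, map_mul, hr]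
    have : s • w v = 0 := by
      rw [← map_smul, show s • v = 0 from funext fun i => AnnihilatorPair.smul_eq_zero_of_mem hs _,
        map_zero]
    rwa [Algebra.smul_def] at this
  intro t ht
  rw [pow_two] at ht
  refine Submodule.mul_induction_on ht (fun s hs' t ht => ?_) fun t t' ht ht' => ?_
  · rw [← mul_assoc, mul_comm r, mem_zeroColon.1 (hs s hs') t ht]
  · rw [mul_add, ht, ht', add_zero]

theorem exists_surjective_of_free [IsLocalRing R] (hI : I ≠ ⊤) (Y : Type u) [AddCommGroup Y]
    [Module R Y] [Module (R ⧸ I) Y] [IsScalarTower R (R ⧸ I) Y] [Module.Free (R ⧸ I) Y]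
    [Nontrivial Y] : ∃ f : Y →ₗ[R] R ⧸ I, Function.Surjective f := by
  have : Nontrivial (R ⧸ I) := Ideal.Quotient.nontrivial_iff.2 hI
  let b := Module.Free.chooseBasis (R ⧸ I) Y
  obtain ⟨i⟩ := b.index_nonempty
  refine ⟨(b.coord i).restrictScalars R, fun s => ⟨s • b i, ?_⟩⟩
  simp

/-- Under (a), `proj` kills the image of s, so Y is a summand of (R/I)ⁿ. Under (b), Y inherits total
reflexivity from M and keeps it over R/I. Either way Y is free over R/I. -/
theorem subsingleton_of_split [IsNoetherianRing R] [IsLocalRing R] (h : AnnihilatorPair I x)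
    (hI : I ≠ ⊤) (hv : ExtVanishes R (R ⧸ I))
    (hab : zeroColon (I ^ 2) = zeroColon I ∨ IsGRegular (R ⧸ I))
    (ha : IsMinimalModulo (I ⊔ zeroColon I) a) {Y : Type u} [AddCommGroup Y]
    [Module R Y] [Module (R ⧸ I) Y] [IsScalarTower R (R ⧸ I) Y]
    (q : ExtensionModule I x a →ₗ[R] Y) (s : Y →ₗ[R] ExtensionModule I x a)
    (hqs : q ∘ₗ s = LinearMap.id) (hq : Function.Surjective (q ∘ₗ incl I x a)) :
    Subsingleton Y := by
  have : Nontrivial (R ⧸ I) := Ideal.Quotient.nontrivial_iff.2 hI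
  have : Module.Finite R Y := Module.Finite.of_surjective _ hq
  have : Module.Finite (R ⧸ I) Y := Module.Finite.of_restrictScalars_finite R _ _
  have hfree : Module.Free (R ⧸ I) Y := by
    rcases hab with hI2 | hG
    · have hz : ∀ y, proj a h (s y) = 0 := fun y => by
        obtain ⟨v, rfl⟩ := hq y
        exact LinearMap.congr_fun
          (hom_eq_zero hI2 (proj a h ∘ₗ s ∘ₗ q ∘ₗ incl I x a)) v
      let t : Y →ₗ[R] (Fin n → R ⧸ I) :=
        (LinearEquiv.ofInjective _ (incl_injective a h)).symm.toLinearMap ∘ₗ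
          s.codRestrict _ fun y => (exact_incl_proj a h _).1 (hz y)
      have ht : ∀ y, incl I x a (t y) = s y := fun y =>
        congrArg Subtype.val ((LinearEquiv.ofInjective _ (incl_injective a h)).apply_symm_apply
          ⟨s y, (exact_incl_proj a h _).1 (hz y)⟩)
      have hsurj : Function.Surjective (algebraMap R (R ⧸ I)) := Ideal.Quotient.mk_surjective
      have : Module.Projective (R ⧸ I) Y := Module.Projective.of_split
        (t.extendScalarsOfSurjective hsurj)
        ((q ∘ₗ incl I x a).extendScalarsOfSurjective hsurj) <| by
          ext y
          change q (incl I x a (t y)) = y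
          rw [ht]
          exact LinearMap.congr_fun hqs y
      have : IsLocalRing (R ⧸ I) :=
        IsLocalRing.of_surjective' (Ideal.Quotient.mk I) Ideal.Quotient.mk_surjective
      exact Module.free_of_flat_of_isLocalRing
    · exact hG Y (h.isTotallyReflexive_of_tower hv
        ((isTotallyReflexive a h hv).of_retract s q hqs))
  by_contra hY
  rw [not_subsingleton_iff_nontrivial] at hY
  obtain ⟨f, hf⟩ := exists_surjective_of_free hI Y
  exact not_surjective_comp_incl h hI ha (f ∘ₗ q) (hf.comp hq)

/-- Since X already covers R/(0 : I), M is the sum of X and the image of (R/I)ⁿ; hence (R/I)ⁿ maps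
onto Y and I kills Y. -/
theorem eq_bot_of_isCompl [IsNoetherianRing R] [IsLocalRing R] (h : AnnihilatorPair I x)
    (hI : I ≠ ⊤) (hv : ExtVanishes R (R ⧸ I))
    (hab : zeroColon (I ^ 2) = zeroColon I ∨ IsGRegular (R ⧸ I))
    (ha : IsMinimalModulo (I ⊔ zeroColon I) a) {X Y : Submodule R (ExtensionModule I x a)}
    (hXY : IsCompl X Y) (hX : X.map (proj a h) = ⊤) : Y = ⊥ := by
  let q := Submodule.projectionOnto Y X hXY.symm
  have hq : Function.Surjective (q ∘ₗ incl I x a) := by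
    intro y
    obtain ⟨z, hz, hzy⟩ := (hX ▸ Submodule.mem_top : proj a h y ∈ X.map (proj a h))
    obtain ⟨v, hv⟩ := (exact_incl_proj a h (y - z)).1 (by rw [map_sub, hzy, sub_self])
    refine ⟨v, ?_⟩
    rw [LinearMap.comp_apply, hv, map_sub, Submodule.projectionOnto_apply_left,
      (Submodule.projectionOnto_apply_eq_zero_iff hXY.symm).2 hz, sub_zero]
  have htors : Module.IsTorsionBySet R Y (I : Set R) := by
    intro y r
    obtain ⟨v, rfl⟩ := hq y
    rw [← map_smul, show (r : R) • v = 0 from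
      funext fun i => AnnihilatorPair.smul_eq_zero_of_mem r.2 _, map_zero]
  let _ : Module (R ⧸ I) Y := htors.module
  have : IsScalarTower R (R ⧸ I) Y := htors.isScalarTower
  have := subsingleton_of_split h hI hv hab ha q Y.subtype
    (LinearMap.ext fun y => Submodule.projectionOnto_apply_left hXY.symm y) hq
  exact Submodule.subsingleton_iff_eq_bot.1 this

theorem isIndecomposable [IsNoetherianRing R] [IsLocalRing R] (h : AnnihilatorPair I x)
    (hI : I ≠ ⊤) (hv : ExtVanishes R (R ⧸ I)) (hx : x ∈ maximalIdeal R)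
    (hab : zeroColon (I ^ 2) = zeroColon I ∨ IsGRegular (R ⧸ I))
    (ha : IsMinimalModulo (I ⊔ zeroColon I) a) :
    IsIndecomposableModule R (ExtensionModule I x a) := by
  have hne : zeroColon I ≠ ⊤ := by
    rw [h.zeroColon_eq, Ne, Ideal.span_singleton_eq_top]
    exact hx
  have : Nontrivial (R ⧸ zeroColon I) := Ideal.Quotient.nontrivial_iff.2 hne
  have hloc : IsLocalRing (R ⧸ zeroColon I) :=
    IsLocalRing.of_surjective' (Ideal.Quotient.mk _) Ideal.Quotient.mk_surjective
  refine ⟨(proj_surjective a h).nontrivial, fun X Y hXY => ?_⟩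
  have key : ∀ (Z : Submodule R (ExtensionModule I x a)) (z : _), z ∈ Z →
      IsUnit (proj a h z) → Z.map (proj a h) = ⊤ := by
    intro Z z hz hu
    rw [eq_top_iff]
    intro s _
    obtain ⟨w, hw⟩ := hu.exists_left_inv
    obtain ⟨r, hr⟩ := Ideal.Quotient.mk_surjective (s * w)
    refine ⟨r • z, Z.smul_mem _ hz, ?_⟩
    rw [map_smul, Algebra.smul_def, Ideal.Quotient.algebraMap_eq, hr, mul_assoc, hw, mul_one]
  obtain ⟨m, hm⟩ := proj_surjective a h 1
  obtain ⟨y, hy, z, hz, rfl⟩ := Submodule.mem_sup.1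
    (hXY.sup_eq_top ▸ Submodule.mem_top : m ∈ X ⊔ Y)
  rw [map_add] at hm
  rcases IsLocalRing.isUnit_or_isUnit_of_add_one hm with hu | hu
  · exact .inr (eq_bot_of_isCompl h hI hv hab ha hXY (key X y hy hu))
  · exact .inl (eq_bot_of_isCompl h hI hv hab ha hXY.symm (key Y z hz hu))

end ExtensionModule

theorem proposition3 {R : Type u} [CommRing R] [IsNoetherianRing R] [IsLocalRing R]
    (I : Ideal R) (hI : IsQuasiGorenstein I) (hgrade : idealGrade I = 0)
    (hab : zeroColon (I ^ 2) = zeroColon I ∨ IsGRegular (R ⧸ I)) :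
    ∃ M : ℕ → R → ModuleCat.{u} R,
      (∀ n : ℕ, 0 < n → (n : ℕ∞) < supGenerators (I ⊔ zeroColon I) → ∀ a : R,
        (∃ (f : (Fin n → R ⧸ I) →ₗ[R] M n a) (g : M n a →ₗ[R] R ⧸ zeroColon I),
          Function.Injective f ∧ Function.Exact f g ∧ Function.Surjective g) ∧
        ¬ Module.Free R (M n a) ∧
        IsIndecomposableModule R (M n a) ∧
        IsTotallyReflexive R (M n a)) ∧
      (∀ n m : ℕ, 0 < n → (n : ℕ∞) < supGenerators (I ⊔ zeroColon I) →
        0 < m → (m : ℕ∞) < supGenerators (I ⊔ zeroColon I) → ∀ a b : R,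
        Nonempty (M n a ≃ₗ[R] M m b) →
        n = m ∧ IsLocalRing.residue R a = IsLocalRing.residue R b) := by
  obtain ⟨x, h⟩ := hI.exists_annihilatorPair hgrade
  have hv : ExtVanishes R (R ⧸ I) := fun i hi => hI.ext_other i (by
    rw [hgrade]
    exact_mod_cast hi.ne')
  have hIm := IsLocalRing.le_maximalIdeal hI.ne_top
  have hx0 : x ≠ 0 := fun hx => (Ideal.ne_top_iff_one I).1 hI.ne_top
    ((h.mul_eq_zero_iff 1).1 (by rw [hx, mul_zero]))
  have hc : ∀ n : ℕ, ∃ c : Fin (n + 1) → R, (n : ℕ∞) < supGenerators (I ⊔ zeroColon I) →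
      IsMinimalModulo (I ⊔ zeroColon I) c := fun n => by
    by_cases hn : (n : ℕ∞) < supGenerators (I ⊔ zeroColon I)
    · obtain ⟨c, hc⟩ := exists_isMinimalModulo _ hn
      exact ⟨c, fun _ => hc⟩
    -- An arbitrary family for n outside the range.
    · exact ⟨0, fun hn' => absurd hn' hn⟩
  choose c hc using hc
  have hx : ∀ n : ℕ, (n : ℕ∞) < supGenerators (I ⊔ zeroColon I) →
      x ∈ IsLocalRing.maximalIdeal R := by
    intro n hn hu
    have htop : I ⊔ zeroColon I = ⊤ := by
      rw [h.zeroColon_eq, Ideal.span_singleton_eq_top.2 hu, sup_top_eq]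
    -- Modulo the unit ideal every relation holds, so minimality would put 1 in the maximal ideal.
    have := hc n hn 1 (by rw [htop]; trivial) 0
    exact (Ideal.ne_top_iff_one _).1 (IsLocalRing.maximalIdeal.isMaximal R).ne_top this
  refine ⟨fun n u => ModuleCat.of R (ExtensionModule I x (twist (c n) u)),
    fun n hn hns u => ⟨?_, ?_, ?_, ?_⟩, fun n m hn hns hm hms u v => ?_⟩
  · exact ⟨_, _, ExtensionModule.incl_injective _ h, ExtensionModule.exact_incl_proj _ h,
      ExtensionModule.proj_surjective _ h⟩
  · exact ExtensionModule.not_free hIm (hx n hns) hx0 ((hc n hns).twist_mem_maximalIdeal hn u)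
  · exact ExtensionModule.isIndecomposable h hI.ne_top hv (hx n hns) hab
      ((hc n hns).twist_isMinimalModulo u)
  · exact ExtensionModule.isTotallyReflexive _ h hv
  · rintro ⟨e⟩
    replace e : ExtensionModule I x (twist (c n) u) ≃ₗ[R] ExtensionModule I x (twist (c m) v) := e
    obtain rfl : n = m := le_antisymm
      (ExtensionModule.le_of_linearEquiv hIm (hx n hns)
        ((hc n hns).twist_mem_maximalIdeal hn u) e.symm)
      (ExtensionModule.le_of_linearEquiv hIm (hx n hns)
        ((hc m hms).twist_mem_maximalIdeal hm v) e)
    refine ⟨rfl, (Ideal.Quotient.eq).2 ((hc n hns).sub_mem_of_twist_mem hn fun i => ?_)⟩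
    rw [h.zeroColon_eq]
    exact ExtensionModule.mem_of_linearEquiv e i
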